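/- Let $\mathbf{AS}$ be the set of absolutely separable two-qubit states, i.e. of the density matrices $\rho$ on $\mathbb{C}^2\otimes\mathbb{C}^2$ such that $U\rho U^\dagger$ is separable (a convex combination of product states) for every unitary $U$ on $\mathbb{C}^2\otimes\mathbb{C}^2$. Let $\rho\in\mathbf{AS}$ have rank $4$, let $\rho\neq \mathbb{I}/4$, and let its eigenvalues $\lambda_1\ge\lambda_2\ge\lambda_3\ge\lambda_4$ satisfy $\lambda_1-\lambda_3<2\sqrt{\lambda_2\lambda_4}$. Then $\rho$ is a convex combination of the maximally mixed state $\mathbb{I}/4$ and a boundary point of $\mathbf{AS}$ (the boundary being taken in the affine hull of $\mathbf{AS}$, the space of Hermitian matrices of trace one). More precisely, there is $\epsilon$ with $0<\epsilon\le\lambda_4$, $4\epsilon<1$ and $\lambda_1-\lambda_3=2\sqrt{(\lambda_2-\epsilon)(\lambda_4-\epsilon)}$ such that $\sigma=(\rho-\epsilon\,\mathbb{I})/(1-4\epsilon)$ belongs to $\mathbf{AS}$ and is a boundary point of $\mathbf{AS}$, and $\rho=(1-4\epsilon)\,\sigma+4\epsilon\,\mathbb{I}/4$. -/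

import Mathlib

open scoped Kronecker ComplexOrder

noncomputable section

/-- A state (density matrix): a positive semidefinite complex matrix of trace one. -/
def IsState {n : Type*} [Fintype n] (ρ : Matrix n n ℂ) : Prop :=
  ρ.PosSemidef ∧ ρ.trace = 1

theorem IsState.isHermitian {n : Type*} [Fintype n] {ρ : Matrix n n ℂ} (h : IsState ρ) :
    ρ.IsHermitian :=
  h.1.isHermitian

/-- The product states of a bipartite system. -/
def productStates (m n : Type*) [Fintype m] [Fintype n] : Set (Matrix (m × n) (m × n) ℂ) :=
  {ρ | ∃ (a : Matrix m m ℂ) (b : Matrix n n ℂ), IsState a ∧ IsState b ∧ ρ = a ⊗ₖ b}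

/-- The separable states: finite convex combinations of product states.
A state that is not separable is entangled. -/
def separableStates (m n : Type*) [Fintype m] [Fintype n] : Set (Matrix (m × n) (m × n) ℂ) :=
  convexHull ℝ (productStates m n)

/-- The set **AS** of absolutely separable states: the states `ρ` that no global unitary
transformation `ρ ↦ U ρ U†` maps to an entangled state. -/
def absSepStates (m n : Type*) [Fintype m] [Fintype n] [DecidableEq m] [DecidableEq n] :
    Set (Matrix (m × n) (m × n) ℂ) :=
  {ρ | IsState ρ ∧ ∀ U ∈ Matrix.unitaryGroup (m × n) ℂ,
    U * ρ * star U ∈ separableStates m n}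

/-- The boundary of **AS**. As all states are Hermitian of trace one, **AS** has empty interior in
the space of all matrices; the boundary of this convex set is taken in its affine hull (which is
the affine space of Hermitian matrices of trace one). -/
def absSepBoundary (m n : Type*) [Fintype m] [Fintype n] [DecidableEq m] [DecidableEq n] :
    Set (Matrix (m × n) (m × n) ℂ) :=
  intrinsicFrontier ℝ (absSepStates m n)

/-- The maximally mixed state `I / 4` of two qubits. -/
def maxMixed : Matrix (Fin 2 × Fin 2) (Fin 2 × Fin 2) ℂ :=
  (1 / 4 : ℝ) • (1 : Matrix (Fin 2 × Fin 2) (Fin 2 × Fin 2) ℂ)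

/-- The four eigenvalues of a Hermitian two-qubit matrix, counted with multiplicity, in decreasing
order: index `0` is the largest eigenvalue `λ₁`, index `3` the smallest eigenvalue `λ₄`. -/
def sortedEigenvalues {ρ : Matrix (Fin 2 × Fin 2) (Fin 2 × Fin 2) ℂ} (h : ρ.IsHermitian)
    (i : Fin 4) : ℝ :=
  h.eigenvalues₀ (Fin.cast (by simp) i)

theorem sortedEigenvalues_antitone {ρ : Matrix (Fin 2 × Fin 2) (Fin 2 × Fin 2) ℂ}
    (h : ρ.IsHermitian) : Antitone (sortedEigenvalues h) := by
  intro i j hij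
  exact h.eigenvalues₀_antitone (by simpa using hij)

end

/-!
For a two-qubit state the condition `λ₁ - λ₃ ≤ 2 √(λ₂ λ₄)` is equivalent to absolute separability
(Verstraete, Audenaert and De Moor). It is necessary because the orbit of the state contains one
that is diagonal in a basis of two Bell states and two product states, whose partial transpose is
positive only under this condition. It is sufficient by Wootters' argument: with respect to the
symmetric form of the spin flip, `ρ = W Wᴴ` can be chosen with `Wᵀ J W` real diagonal with entries
`s₁ ≥ s₂ ≥ s₃ ≥ s₄ ≥ 0`, and if `s₁ ≤ s₂ + s₃ + s₄` a further unitary mixing makes all diagonal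
entries vanish, which turns the columns into product vectors. The inequality between the `sᵢ`
follows from the von Neumann trace inequality applied to `ρ` and a Hermitian `H` with
`tr (ρ H) = s₂ + s₃ + s₄ - s₁` and spectrum `r, 1, r⁻¹, -1`: pairing it with the eigenvalues of `ρ`
in the opposite order gives at least `λ₃ - λ₁ + 2 √(λ₂ λ₄)`.

Moving from a state that saturates the condition away from `I / 4` violates it, so such states lie
on the boundary. Subtracting `ε I` from `ρ` shrinks `2 √(λ₂ λ₄)` continuously to zero while
`λ₁ - λ₃` is unchanged, so some `ε` gives equality.
-/

noncomputable section

open Matrix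

variable {n : Type*} [Fintype n] [DecidableEq n]

/-- The complex diagonal matrices with real entries, as an algebra homomorphism from the real
tuples. -/
def realDiagonal : (n → ℝ) →ₐ[ℝ] Matrix n n ℂ :=
  (diagonalAlgHom ℝ).comp (Complex.ofRealAm.compLeft n)

theorem realDiagonal_eq_diagonal (s : n → ℝ) :
    realDiagonal s = diagonal fun i => (s i : ℂ) := rfl

theorem conjTranspose_realDiagonal (s : n → ℝ) : (realDiagonal s)ᴴ = realDiagonal s := by
  simp [realDiagonal_eq_diagonal, diagonal_conjTranspose, Pi.star_def]

theorem transpose_realDiagonal (s : n → ℝ) : (realDiagonal s)ᵀ = realDiagonal s :=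
  diagonal_transpose _

theorem charpoly_realDiagonal (s : n → ℝ) :
    (realDiagonal s).charpoly = ∏ i, (Polynomial.X - Polynomial.C (s i : ℂ)) :=
  charpoly_diagonal _

theorem exists_unitary_conj_realDiagonal {A : Matrix n n ℂ} (hA : A.IsHermitian) :
    ∃ U ∈ unitaryGroup n ℂ, A = U * realDiagonal hA.eigenvalues * star U := by
  refine ⟨hA.eigenvectorUnitary, hA.eigenvectorUnitary.2, ?_⟩
  exact hA.spectral_theorem.trans (Unitary.conjStarAlgAut_apply _ _)

theorem charpoly_unitary_conj {U : Matrix n n ℂ} (hU : U ∈ unitaryGroup n ℂ)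
    (A : Matrix n n ℂ) : (U * A * star U).charpoly = A.charpoly := by
  rw [charpoly_mul_comm, ← mul_assoc, mem_unitaryGroup_iff'.1 hU, one_mul]

theorem exists_unitary_conj_eq_of_charpoly_eq {A B : Matrix n n ℂ} (hA : A.IsHermitian)
    (hB : B.IsHermitian) (h : A.charpoly = B.charpoly) :
    ∃ U ∈ unitaryGroup n ℂ, U * A * star U = B := by
  obtain ⟨V, hV, hAV⟩ := exists_unitary_conj_realDiagonal hA
  obtain ⟨W, hW, hBW⟩ := exists_unitary_conj_realDiagonal hB
  refine ⟨W * star V, mul_mem hW (Unitary.star_mem hV), ?_⟩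
  rw [hBW, ← (hA.eigenvalues_eq_eigenvalues_iff hB).2 h]
  have hVV : star V * V = 1 := mem_unitaryGroup_iff'.1 hV
  calc W * star V * A * star (W * star V)
      = W * (star V * V) * realDiagonal hA.eigenvalues * (star V * V) * star W := by
        rw [star_mul, star_star]
        nth_rw 1 [hAV]
        simp only [mul_assoc]
    _ = W * realDiagonal hA.eigenvalues * star W := by simp only [hVV, mul_one]

theorem eq_of_antitone_of_map_univ_eq {k : ℕ} {μ ξ : Fin k → ℝ} (hμ : Antitone μ)
    (hξ : Antitone ξ) (h : Finset.univ.val.map μ = Finset.univ.val.map ξ) : μ = ξ := by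
  rw [Fin.univ_val_map, Fin.univ_val_map, Multiset.coe_eq_coe] at h
  exact List.ofFn_injective (h.eq_of_sortedGE hμ.sortedGE_ofFn hξ.sortedGE_ofFn)

theorem eq_of_antitone_of_prod_X_sub_C_eq {k : ℕ} {μ ξ : Fin k → ℝ} (hμ : Antitone μ)
    (hξ : Antitone ξ) (h : ∏ i, (Polynomial.X - Polynomial.C (μ i : ℂ)) =
      ∏ i, (Polynomial.X - Polynomial.C (ξ i : ℂ))) : μ = ξ := by
  refine eq_of_antitone_of_map_univ_eq hμ hξ (Multiset.map_injective Complex.ofReal_injective ?_)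
  have hroots := congrArg Polynomial.roots h
  rw [Polynomial.roots_prod _ _ (Finset.prod_ne_zero_iff.2 fun i _ => Polynomial.X_sub_C_ne_zero _),
    Polynomial.roots_prod _ _ (Finset.prod_ne_zero_iff.2 fun i _ => Polynomial.X_sub_C_ne_zero _)]
    at hroots
  simpa [Multiset.map_map, Multiset.bind_singleton, Function.comp_def] using hroots

theorem exists_equiv_eigenvalues_eq {A : Matrix (Fin 2 × Fin 2) (Fin 2 × Fin 2) ℂ}
    (hA : A.IsHermitian) :
    ∃ e : Fin 2 × Fin 2 ≃ Fin 4, hA.eigenvalues = sortedEigenvalues hA ∘ e :=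
  ⟨(Fintype.equivOfCardEq (Fintype.card_fin _)).symm.trans (finCongr (by simp)), rfl⟩

theorem charpoly_cfc_eq_prod_sortedEigenvalues {A : Matrix (Fin 2 × Fin 2) (Fin 2 × Fin 2) ℂ}
    (hA : A.IsHermitian) (f : ℝ → ℝ) :
    (cfc f A).charpoly =
      ∏ i, (Polynomial.X - Polynomial.C (f (sortedEigenvalues hA i) : ℂ)) := by
  obtain ⟨e, he⟩ := exists_equiv_eigenvalues_eq hA
  rw [hA.charpoly_cfc_eq f]
  exact Fintype.prod_equiv e _ _ fun i => by rw [he]; rfl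

theorem charpoly_eq_prod_sortedEigenvalues {A : Matrix (Fin 2 × Fin 2) (Fin 2 × Fin 2) ℂ}
    (hA : A.IsHermitian) :
    A.charpoly = ∏ i, (Polynomial.X - Polynomial.C (sortedEigenvalues hA i : ℂ)) := by
  have h := charpoly_cfc_eq_prod_sortedEigenvalues hA fun x => x
  rwa [cfc_id' ℝ A hA.isSelfAdjoint] at h

theorem sortedEigenvalues_eq {A : Matrix (Fin 2 × Fin 2) (Fin 2 × Fin 2) ℂ} (hA : A.IsHermitian)
    {μ : Fin 4 → ℝ} (hμ : Antitone μ)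
    (h : A.charpoly = ∏ i, (Polynomial.X - Polynomial.C (μ i : ℂ))) :
    sortedEigenvalues hA = μ :=
  eq_of_antitone_of_prod_X_sub_C_eq (sortedEigenvalues_antitone hA) hμ
    ((charpoly_eq_prod_sortedEigenvalues hA).symm.trans h)

theorem sum_sortedEigenvalues {A : Matrix (Fin 2 × Fin 2) (Fin 2 × Fin 2) ℂ}
    (hA : A.IsHermitian) : ∑ i, sortedEigenvalues hA i = (trace A).re := by
  obtain ⟨e, he⟩ := exists_equiv_eigenvalues_eq hA
  rw [hA.trace_eq_sum_eigenvalues, Complex.re_sum, he]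
  exact (e.sum_comp _).symm

theorem posSemidef_iff_sortedEigenvalues_nonneg {A : Matrix (Fin 2 × Fin 2) (Fin 2 × Fin 2) ℂ}
    (hA : A.IsHermitian) : A.PosSemidef ↔ ∀ i, 0 ≤ sortedEigenvalues hA i := by
  obtain ⟨e, he⟩ := exists_equiv_eigenvalues_eq hA
  rw [hA.posSemidef_iff_eigenvalues_nonneg, he]
  exact e.forall_congr fun _ => Iff.rfl

theorem sortedEigenvalues_eq_of_eq_smul_add_smul_one
    {A B : Matrix (Fin 2 × Fin 2) (Fin 2 × Fin 2) ℂ} (hA : A.IsHermitian) (hB : B.IsHermitian)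
    {a b : ℝ} (ha : 0 ≤ a) (h : B = a • A + b • 1) :
    sortedEigenvalues hB = fun i => a * sortedEigenvalues hA i + b := by
  have hcfc : B = cfc (fun x => a * x + b) A := by
    rw [cfc_add_const b (a * ·) A (by fun_prop) hA.isSelfAdjoint,
      cfc_const_mul_id a A hA.isSelfAdjoint, Algebra.algebraMap_eq_smul_one, h]
  refine sortedEigenvalues_eq hB (fun i j hij => ?_) ?_
  · have := sortedEigenvalues_antitone hA hij
    gcongr
  · rw [hcfc, charpoly_cfc_eq_prod_sortedEigenvalues hA]

/-! ### The von Neumann trace inequality -/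

theorem exists_permMatrix_le_of_mem_doublyStochastic {S : Matrix n n ℝ}
    (hS : S ∈ doublyStochastic ℝ n) (f : Matrix n n ℝ →ₗ[ℝ] ℝ) :
    ∃ τ : Equiv.Perm n, f (τ.permMatrix ℝ) ≤ f S := by
  have hS' : S ∈ (doublyStochastic ℝ n : Set (Matrix n n ℝ)) := hS
  rw [doublyStochastic_eq_convexHull_permMatrix] at hS'
  obtain ⟨_, ⟨τ, rfl⟩, hτ⟩ :=
    (f.concaveOn convex_univ).exists_le_of_mem_convexHull (Set.subset_univ _) hS'
  exact ⟨τ, hτ⟩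

theorem norm_sq_mem_doublyStochastic {U : Matrix n n ℂ} (hU : U ∈ unitaryGroup n ℂ) :
    U.map (‖·‖ ^ 2) ∈ doublyStochastic ℝ n := by
  rw [mem_doublyStochastic_iff_sum]
  refine ⟨fun i j => by simp, fun i => ?_, fun j => ?_⟩
  · have h := congrFun₂ (mem_unitaryGroup_iff.1 hU) i i
    simp only [mul_apply, star_apply, RCLike.star_def, Complex.mul_conj', one_apply_eq] at h
    exact_mod_cast h
  · have h := congrFun₂ (mem_unitaryGroup_iff'.1 hU) j j
    simp only [mul_apply, star_apply, RCLike.star_def, Complex.conj_mul', one_apply_eq] at h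
    exact_mod_cast h

theorem trace_realDiagonal_mul_conj_realDiagonal (a b : n → ℝ) (U : Matrix n n ℂ) :
    trace (realDiagonal a * (U * realDiagonal b * star U)) =
      (a ⬝ᵥ U.map (‖·‖ ^ 2) *ᵥ b : ℝ) := by
  rw [trace, dotProduct, Complex.ofReal_sum]
  refine Finset.sum_congr rfl fun i _ => ?_
  rw [diag_apply, realDiagonal_eq_diagonal, diagonal_mul, mul_apply, mulVec, dotProduct,
    Complex.ofReal_mul, Complex.ofReal_sum]
  refine congrArg _ (Finset.sum_congr rfl fun j _ => ?_)
  rw [realDiagonal_eq_diagonal, mul_diagonal, map_apply, star_apply, RCLike.star_def,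
    Complex.ofReal_mul, Complex.ofReal_pow, ← Complex.mul_conj']
  ring

theorem exists_perm_sum_eigenvalues_mul_le_re_trace {A B : Matrix n n ℂ} (hA : A.IsHermitian)
    (hB : B.IsHermitian) : ∃ τ : Equiv.Perm n,
      ∑ i, hA.eigenvalues i * hB.eigenvalues (τ i) ≤ (trace (A * B)).re := by
  obtain ⟨U, hU, hAU⟩ := exists_unitary_conj_realDiagonal hA
  obtain ⟨V, hV, hBV⟩ := exists_unitary_conj_realDiagonal hB
  set a := hA.eigenvalues
  set b := hB.eigenvalues
  have hW : star U * V ∈ unitaryGroup n ℂ := mul_mem (Unitary.star_mem hU) hV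
  have htrace : trace (A * B) =
      trace (realDiagonal a * ((star U * V) * realDiagonal b * star (star U * V))) := by
    rw [hAU, hBV, star_mul, star_star, mul_assoc, mul_assoc, trace_mul_comm]
    simp only [mul_assoc]
  obtain ⟨τ, hτ⟩ := exists_permMatrix_le_of_mem_doublyStochastic (norm_sq_mem_doublyStochastic hW)
    ((dotProductBilin ℝ ℝ a).comp ((mulVecBilin ℝ ℝ).flip b))
  refine ⟨τ, ?_⟩
  rw [htrace, trace_realDiagonal_mul_conj_realDiagonal, Complex.ofReal_re]
  simpa [permMatrix_mulVec, dotProduct] using hτ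

theorem sum_mul_rev_le_sum_mul_comp {ι : Type*} [Fintype ι] {k : ℕ} {μ ξ : Fin k → ℝ}
    (hμ : Antitone μ) (hξ : Antitone ξ) (e f : ι ≃ Fin k) :
    ∑ i, μ i * ξ i.rev ≤ ∑ i, μ (e i) * ξ (f i) := by
  have hvary : Antivary μ (ξ ∘ Fin.rev) :=
    hμ.antivary fun i j hij => hξ (Fin.rev_le_rev.2 hij)
  refine (hvary.sum_mul_le_sum_mul_comp_perm (σ := (e.symm.trans f).trans Fin.revPerm)).trans_eq ?_
  rw [← e.sum_comp]
  simp

theorem sum_sortedEigenvalues_mul_rev_le_re_trace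
    {A B : Matrix (Fin 2 × Fin 2) (Fin 2 × Fin 2) ℂ} (hA : A.IsHermitian) (hB : B.IsHermitian) :
    ∑ i, sortedEigenvalues hA i * sortedEigenvalues hB i.rev ≤ (trace (A * B)).re := by
  obtain ⟨e, he⟩ := exists_equiv_eigenvalues_eq hA
  obtain ⟨f, hf⟩ := exists_equiv_eigenvalues_eq hB
  obtain ⟨τ, hτ⟩ := exists_perm_sum_eigenvalues_mul_le_re_trace hA hB
  rw [he, hf] at hτ
  exact (sum_mul_rev_le_sum_mul_comp (sortedEigenvalues_antitone hA)
    (sortedEigenvalues_antitone hB) e (τ.trans f)).trans hτ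

/-! ### The Takagi factorization -/

variable (n) in
theorem isCompact_unitaryGroup : IsCompact (unitaryGroup n ℂ : Set (Matrix n n ℂ)) := by
  have hcompact : IsCompact (Set.univ.pi fun _ : n => Set.univ.pi fun _ : n =>
      Metric.closedBall (0 : ℂ) 1) :=
    isCompact_univ_pi fun _ => isCompact_univ_pi fun _ => isCompact_closedBall _ _
  refine hcompact.of_isClosed_subset (isClosed_unitary (R := Matrix n n ℂ)) fun U hU i _ j _ => ?_
  simpa using entry_norm_bound_of_unitary hU i j

open scoped Matrix.Norms.L2Operator in
theorem exp_mem_unitaryGroup {K : Matrix n n ℂ} (hK : K ∈ skewAdjoint (Matrix n n ℂ)) :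
    NormedSpace.exp K ∈ unitaryGroup n ℂ := by
  let +nondep : NormedAlgebra ℚ (Matrix n n ℂ) := .restrictScalars ℚ ℂ _
  exact NormedSpace.exp_mem_unitary_of_mem_skewAdjoint hK

open scoped Matrix.Norms.L2Operator in
theorem hasDerivAt_trace_mul_transpose_exp_mul_exp (D N K : Matrix n n ℂ) :
    HasDerivAt (fun t : ℝ => trace (D * ((NormedSpace.exp (t • K))ᵀ * N * NormedSpace.exp (t • K))))
      (trace (D * (Kᵀ * N + N * K))) 0 := by
  have hexp := hasDerivAt_exp_smul_const (𝕂 := ℝ) K (0 : ℝ)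
  have hexpT := hasDerivAt_exp_smul_const (𝕂 := ℝ) Kᵀ (0 : ℝ)
  have hprod := ((hexpT.mul_const N).mul hexp).const_mul D
  have htrace := (traceLinearMap n ℝ ℂ).toContinuousLinearMap.hasFDerivAt.comp_hasDerivAt 0 hprod
  simp only [← exp_transpose, transpose_smul]
  refine htrace.congr_deriv ?_
  change trace _ = trace _
  simp only [zero_smul, NormedSpace.exp_zero, one_mul, mul_one]

omit [DecidableEq n] in
theorem isHermitian_of_re_trace_mul_eq_zero {A : Matrix n n ℂ}
    (h : ∀ K ∈ skewAdjoint (Matrix n n ℂ), (trace (A * K)).re = 0) : A.IsHermitian := by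
  have hskew : A - Aᴴ ∈ skewAdjoint (Matrix n n ℂ) := by
    simp [skewAdjoint.mem_iff, star_eq_conjTranspose]
  have htrace : trace ((A - Aᴴ)ᴴ * (A - Aᴴ)) =
      -(trace (A * (A - Aᴴ)) + star (trace (A * (A - Aᴴ)))) := by
    rw [← trace_conjTranspose, conjTranspose_mul]
    simp only [conjTranspose_sub, conjTranspose_conjTranspose, mul_sub, sub_mul, trace_sub]
    rw [trace_mul_comm Aᴴ A]
    ring
  have hzero : trace ((A - Aᴴ)ᴴ * (A - Aᴴ)) = 0 := by
    rw [htrace, RCLike.star_def, Complex.add_conj, h _ hskew]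
    simp
  exact (sub_eq_zero.1 (trace_conjTranspose_mul_self_eq_zero_iff.1 hzero)).symm

theorem isHermitian_mul_of_re_trace_le {D N : Matrix n n ℂ} (hD : Dᵀ = D) (hN : Nᵀ = N)
    (h : ∀ U ∈ unitaryGroup n ℂ, (trace (D * (Uᵀ * N * U))).re ≤ (trace (D * N)).re) :
    (D * N).IsHermitian := by
  refine isHermitian_of_re_trace_mul_eq_zero fun K hK => ?_
  have hderiv : HasDerivAt (fun t : ℝ => (trace (D * ((NormedSpace.exp (t • K))ᵀ * N *
      NormedSpace.exp (t • K)))).re) (trace (D * (Kᵀ * N + N * K))).re 0 :=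
    Complex.reCLM.hasFDerivAt.comp_hasDerivAt 0 (hasDerivAt_trace_mul_transpose_exp_mul_exp D N K)
  have hmax : IsLocalMax (fun t : ℝ => (trace (D * ((NormedSpace.exp (t • K))ᵀ * N *
      NormedSpace.exp (t • K)))).re) 0 := .of_forall fun t => by
    simpa [NormedSpace.exp_zero] using
      h _ (exp_mem_unitaryGroup (skewAdjoint.smul_mem t hK))
  have hcrit := hmax.hasDerivAt_eq_zero hderiv
  have hsymm : trace (D * (Kᵀ * N)) = trace (D * (N * K)) := by
    rw [← trace_transpose]
    simp only [transpose_mul, hN, hD, transpose_transpose]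
    exact trace_mul_comm _ _
  rw [mul_add, trace_add, hsymm, Complex.add_re] at hcrit
  rw [mul_assoc]
  linarith

theorem eq_zero_of_isHermitian_realDiagonal_mul {N : Matrix n n ℂ} (hN : Nᵀ = N) {d : n → ℝ}
    (hpos : ∀ i, 0 < d i) (hd : Function.Injective d) (h : (realDiagonal d * N).IsHermitian)
    {i j : n} (hij : i ≠ j) : N i j = 0 := by
  have hentry : d i * ‖N i j‖ = d j * ‖N i j‖ := by
    have := congrArg norm (h.apply i j)
    simpa [realDiagonal_eq_diagonal, diagonal_mul, ← congrFun₂ hN i j, abs_of_pos (hpos _)]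
      using this.symm
  by_contra hne
  exact hij (hd (mul_right_cancel₀ (norm_ne_zero_iff.2 hne) hentry))

theorem exists_mul_mul_self_eq_norm (z : ℂ) : ∃ u : ℂ, ‖u‖ = 1 ∧ u * z * u = ‖z‖ := by
  refine ⟨Complex.exp ((-z.arg / 2 : ℝ) * Complex.I), Complex.norm_exp_ofReal_mul_I _, ?_⟩
  have hexp : Complex.exp ((-z.arg / 2 : ℝ) * Complex.I) * Complex.exp (z.arg * Complex.I) *
      Complex.exp ((-z.arg / 2 : ℝ) * Complex.I) = 1 := by
    rw [← Complex.exp_add, ← Complex.exp_add, ← Complex.exp_zero]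
    congr 1
    push_cast
    ring
  nth_rw 2 [← Complex.norm_mul_exp_arg_mul_I z]
  linear_combination (‖z‖ : ℂ) * hexp

theorem diagonal_mem_unitaryGroup {u : n → ℂ} (hu : ∀ i, ‖u i‖ = 1) :
    diagonal u ∈ unitaryGroup n ℂ := by
  rw [mem_unitaryGroup_iff', star_eq_conjTranspose, diagonal_conjTranspose, diagonal_mul_diagonal,
    ← diagonal_one]
  refine congrArg _ (funext fun i => ?_)
  simp [Complex.conj_mul', hu]

-- A unitary congruence `Vᵀ M V` maximizing `Re tr (D Vᵀ M V)`, for a fixed positive diagonal `D`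
-- with distinct entries, is diagonal.
theorem exists_unitary_congr_eq_realDiagonal {M : Matrix n n ℂ} (hM : Mᵀ = M) :
    ∃ V ∈ unitaryGroup n ℂ, ∃ s : n → ℝ, (∀ i, 0 ≤ s i) ∧ Vᵀ * M * V = realDiagonal s := by
  let d : n → ℝ := fun i => (Fintype.equivFin n i : ℝ) + 1
  have hd : Function.Injective d := fun i j hij => by simpa [d, Fin.val_inj] using hij
  obtain ⟨V, hV, hmax⟩ := (isCompact_unitaryGroup n).exists_isMaxOn ⟨1, one_mem _⟩
    (f := fun U => (trace (realDiagonal d * (Uᵀ * M * U))).re) (by fun_prop)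
  set N := Vᵀ * M * V with hN
  have hNsymm : Nᵀ = N := by simp [hN, hM, mul_assoc]
  have hherm : (realDiagonal d * N).IsHermitian :=
    isHermitian_mul_of_re_trace_le (transpose_realDiagonal d) hNsymm fun U hU => by
      simpa [hN, mul_assoc] using hmax (mul_mem hV hU)
  choose u hu huN using fun i => exists_mul_mul_self_eq_norm (N i i)
  refine ⟨V * diagonal u, mul_mem hV (diagonal_mem_unitaryGroup hu), fun i => ‖N i i‖,
    fun i => norm_nonneg _, ?_⟩
  have hassoc : (V * diagonal u)ᵀ * M * (V * diagonal u) = diagonal u * N * diagonal u := by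
    simp only [transpose_mul, diagonal_transpose, hN, mul_assoc]
  rw [hassoc, realDiagonal_eq_diagonal]
  ext i j
  rw [mul_diagonal, diagonal_mul]
  obtain rfl | hij := eq_or_ne i j
  · rw [huN, diagonal_apply_eq]
  · rw [eq_zero_of_isHermitian_realDiagonal_mul hNsymm (fun i => by positivity) hd hherm hij,
      diagonal_apply_ne _ hij, mul_zero, zero_mul]

/-! ### Hermitian witnesses orthogonal for a symmetric form -/

theorem star_dotProduct_realDiagonal_mulVec (d : n → ℝ) (w : n → ℂ) :
    star w ⬝ᵥ realDiagonal d *ᵥ w = (∑ i, d i * ‖w i‖ ^ 2 : ℝ) := by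
  rw [dotProduct, Complex.ofReal_sum]
  refine Finset.sum_congr rfl fun i _ => ?_
  rw [realDiagonal_eq_diagonal, mulVec_diagonal, Pi.star_apply, RCLike.star_def, mul_left_comm,
    Complex.conj_mul', Complex.ofReal_mul, Complex.ofReal_pow]

theorem star_dotProduct_conj_realDiagonal_mulVec (P : Matrix n n ℂ) (d : n → ℝ) (x : n → ℂ) :
    star x ⬝ᵥ (P * realDiagonal d * Pᴴ) *ᵥ x = (∑ i, d i * ‖(Pᴴ *ᵥ x) i‖ ^ 2 : ℝ) := by
  rw [← star_dotProduct_realDiagonal_mulVec, star_mulVec, conjTranspose_conjTranspose,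
    ← dotProduct_mulVec, mulVec_mulVec, mulVec_mulVec, mul_assoc]

omit [Fintype n] [DecidableEq n] in
theorem exists_ne_zero_of_linearMap_eq_zero (φ : (n → ℂ) →ₗ[ℂ] ℂ) {i j : n} (hij : i ≠ j) :
    ∃ w : n → ℂ, φ w = 0 ∧ (w i ≠ 0 ∨ w j ≠ 0) ∧ ∀ l, l ≠ i → l ≠ j → w l = 0 := by
  classical
  by_cases hi : φ (Pi.single i 1) = 0
  · exact ⟨Pi.single i 1, hi, .inl (by simp), fun l hl _ => Pi.single_eq_of_ne hl _⟩
  · refine ⟨φ (Pi.single j 1) • Pi.single i 1 - φ (Pi.single i 1) • Pi.single j 1, ?_, .inr ?_,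
      fun l hl hl' => by simp [hl, hl']⟩
    · simp only [map_sub, map_smul, smul_eq_mul]
      ring
    · simpa [hij.symm] using hi

theorem nonneg_or_nonneg_of_linearMap_eq_zero {A : Matrix n n ℂ} (hA : A.IsHermitian)
    (φ : (n → ℂ) →ₗ[ℂ] ℂ) (h : ∀ x, φ x = 0 → 0 ≤ star x ⬝ᵥ A *ᵥ x) {i j : n} (hij : i ≠ j) :
    0 ≤ hA.eigenvalues i ∨ 0 ≤ hA.eigenvalues j := by
  obtain ⟨U, hU, hAU⟩ := exists_unitary_conj_realDiagonal hA
  set a := hA.eigenvalues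
  obtain ⟨w, hφ, hwij, hw⟩ := exists_ne_zero_of_linearMap_eq_zero (φ ∘ₗ U.mulVecLin) hij
  have hUw : Uᴴ *ᵥ U *ᵥ w = w := by
    rw [mulVec_mulVec, ← star_eq_conjTranspose, mem_unitaryGroup_iff'.1 hU, one_mulVec]
  have hform := h _ hφ
  rw [mulVecLin_apply, hAU, star_eq_conjTranspose, star_dotProduct_conj_realDiagonal_mulVec, hUw,
    Complex.zero_le_real,
    Fintype.sum_eq_add i j hij fun l hl => by rw [hw l hl.1 hl.2]; simp] at hform
  by_contra! hneg
  rcases hwij with hwi | hwj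
  · have : 0 < ‖w i‖ ^ 2 := by positivity
    nlinarith [sq_nonneg ‖w j‖]
  · have : 0 < ‖w j‖ ^ 2 := by positivity
    nlinarith [sq_nonneg ‖w i‖]

/-- The diagonal of the reflection negating the coordinate `k`. -/
def reflectionSigns (k : n) : n → ℝ := Function.update 1 k (-1)

omit [Fintype n] in
theorem reflectionSigns_mul_self (k : n) : reflectionSigns k * reflectionSigns k = 1 := by
  ext i
  obtain rfl | hi := eq_or_ne i k <;> simp [reflectionSigns, *]

/-- The Hermitian matrix congruent by `P` to a reflection. For `P` orthogonal with respect to the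
symmetric form whose values on `ρ` give the concurrence, it plays the role of an entanglement
witness. -/
def reflectionWitness (P : Matrix n n ℂ) (k : n) : Matrix n n ℂ :=
  P * realDiagonal (reflectionSigns k) * Pᴴ

theorem isHermitian_reflectionWitness (P : Matrix n n ℂ) (k : n) :
    (reflectionWitness P k).IsHermitian :=
  isHermitian_mul_mul_conjTranspose P (conjTranspose_realDiagonal _)

theorem nonneg_or_nonneg_eigenvalues_reflectionWitness (P : Matrix n n ℂ) (k : n) {i j : n}
    (hij : i ≠ j) : 0 ≤ (isHermitian_reflectionWitness P k).eigenvalues i ∨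
      0 ≤ (isHermitian_reflectionWitness P k).eigenvalues j := by
  refine nonneg_or_nonneg_of_linearMap_eq_zero _ (LinearMap.proj k ∘ₗ Pᴴ.mulVecLin) ?_ hij
  intro x (hx : (Pᴴ *ᵥ x) k = 0)
  rw [reflectionWitness, star_dotProduct_conj_realDiagonal_mulVec, Complex.zero_le_real]
  refine Finset.sum_nonneg fun l _ => ?_
  obtain rfl | hl := eq_or_ne l k
  · simp [hx]
  · simp [reflectionSigns, hl]

theorem not_posSemidef_reflectionWitness {P Q : Matrix n n ℂ} (h : Q * P = 1) (k : n) :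
    ¬ (reflectionWitness P k).PosSemidef := by
  intro hpos
  have hQ : Q * reflectionWitness P k * Qᴴ = realDiagonal (reflectionSigns k) := by
    calc Q * reflectionWitness P k * Qᴴ
        = (Q * P) * realDiagonal (reflectionSigns k) * (Q * P)ᴴ := by
          rw [reflectionWitness, conjTranspose_mul]
          simp only [mul_assoc]
      _ = realDiagonal (reflectionSigns k) := by rw [h, conjTranspose_one, one_mul, mul_one]
  have hdiag := (hpos.mul_mul_conjTranspose_same Q).diag_nonneg (i := k)
  rw [hQ, realDiagonal_eq_diagonal, diagonal_apply_eq, Complex.zero_le_real] at hdiag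
  simp only [reflectionSigns, Function.update_self] at hdiag
  linarith

theorem trace_mul_reflectionWitness {ρ P : Matrix n n ℂ} {s : n → ℝ}
    (h : Pᴴ * ρ * P = realDiagonal s) (k : n) :
    trace (ρ * reflectionWitness P k) = (∑ i, s i - 2 * s k : ℝ) := by
  have hsum : ∑ i, s i * reflectionSigns k i = ∑ i, s i - 2 * s k := by
    rw [← Finset.add_sum_erase _ _ (Finset.mem_univ k),
      ← Finset.add_sum_erase _ s (Finset.mem_univ k), Finset.sum_congr rfl fun i hi => by
        rw [reflectionSigns, Function.update_of_ne (Finset.ne_of_mem_erase hi), Pi.one_apply,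
          mul_one]]
    rw [reflectionSigns, Function.update_self]
    ring
  calc trace (ρ * reflectionWitness P k)
      = trace (Pᴴ * ρ * P * realDiagonal (reflectionSigns k)) := by
        rw [reflectionWitness, ← mul_assoc, trace_mul_comm]
        simp only [mul_assoc]
    _ = (∑ i, s i - 2 * s k : ℝ) := by
        rw [h, ← map_mul, realDiagonal_eq_diagonal, trace_diagonal, ← hsum, Complex.ofReal_sum]
        rfl

section SymmetricForm

variable {J P W : Matrix n n ℂ}

omit [DecidableEq n] in
theorem conjTranspose_mul_mul_conj (hJh : Jᴴ = J) (A : Matrix n n ℂ) :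
    Aᴴ * J * Aᴴᵀ = (Aᵀ * J * A)ᴴ := by
  rw [conjTranspose_mul, conjTranspose_mul, hJh, ← mul_assoc]
  rfl

theorem reflectionWitness_mul_eq_one (hJh : Jᴴ = J) (hP : Pᵀ * J * P = 1)
    (k : n) : reflectionWitness P k * (J * (reflectionWitness P k)ᵀ * J) = 1 := by
  have hPbar : Pᴴ * J * Pᴴᵀ = 1 := by
    rw [conjTranspose_mul_mul_conj hJh, hP, conjTranspose_one]
  set D := realDiagonal (reflectionSigns k) with hD
  have hDt : Dᵀ = D := transpose_realDiagonal _
  have hDD : D * D = 1 := by rw [hD, ← map_mul, reflectionSigns_mul_self, map_one]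
  calc reflectionWitness P k * (J * (reflectionWitness P k)ᵀ * J)
      = P * D * (Pᴴ * J * Pᴴᵀ) * D * Pᵀ * J := by
        simp only [reflectionWitness, transpose_mul, hDt, mul_assoc, ← hD]
    _ = P * (D * D) * (Pᵀ * J) := by rw [hPbar, mul_one]; simp only [mul_assoc]
    _ = 1 := by rw [hDD, mul_one, mul_eq_one_comm.1 hP]

theorem charpoly_inv_reflectionWitness (hJ : J * J = 1) (hJh : Jᴴ = J)
    (hP : Pᵀ * J * P = 1) (k : n) :
    (reflectionWitness P k)⁻¹.charpoly = (reflectionWitness P k).charpoly := by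
  rw [inv_eq_right_inv (reflectionWitness_mul_eq_one hJh hP k), charpoly_mul_comm,
    ← mul_assoc, hJ, one_mul, charpoly_transpose]

theorem exists_orthogonal_conj_eq_realDiagonal (hJ : J * J = 1) (hJt : Jᵀ = J) (hJh : Jᴴ = J)
    {s : n → ℝ} (hs : ∀ i, 0 < s i) (hW : Wᵀ * J * W = realDiagonal s) :
    ∃ P : Matrix n n ℂ, Pᵀ * J * P = 1 ∧ Pᴴ * (W * Wᴴ) * P = realDiagonal s := by
  set r : n → ℝ := fun i => (√(s i))⁻¹
  have hr : r * s * r = 1 := by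
    ext i
    have := Real.mul_self_sqrt (hs i).le
    have := (Real.sqrt_pos.2 (hs i)).ne'
    simp only [Pi.mul_apply, Pi.one_apply, r]
    field_simp
    nlinarith
  have hWbar : Wᴴ * J * Wᴴᵀ = realDiagonal s := by
    rw [conjTranspose_mul_mul_conj hJh, hW, conjTranspose_realDiagonal]
  have hPW : (J * Wᴴᵀ * realDiagonal r)ᴴ * W = realDiagonal (r * s) := by
    rw [conjTranspose_mul, conjTranspose_mul, conjTranspose_realDiagonal, hJh, map_mul, ← hW,
      show Wᴴᵀᴴ = Wᵀ from congrArg transpose (conjTranspose_conjTranspose W)]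
    simp only [mul_assoc]
  refine ⟨J * Wᴴᵀ * realDiagonal r, ?_, ?_⟩
  · calc (J * Wᴴᵀ * realDiagonal r)ᵀ * J * (J * Wᴴᵀ * realDiagonal r)
        = realDiagonal r * (Wᴴ * (J * (J * J)) * Wᴴᵀ) * realDiagonal r := by
          simp only [transpose_mul, transpose_realDiagonal, hJt, transpose_transpose, mul_assoc]
      _ = 1 := by rw [hJ, mul_one, hWbar, ← map_mul, ← map_mul, hr, map_one]
  · calc (J * Wᴴᵀ * realDiagonal r)ᴴ * (W * Wᴴ) * (J * Wᴴᵀ * realDiagonal r)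
        = ((J * Wᴴᵀ * realDiagonal r)ᴴ * W) * ((J * Wᴴᵀ * realDiagonal r)ᴴ * W)ᴴ := by
          rw [conjTranspose_mul _ W, conjTranspose_conjTranspose]
          simp only [mul_assoc]
      _ = realDiagonal s := by
          rw [hPW, conjTranspose_realDiagonal, ← map_mul,
            show r * s * (r * s) = (r * s * r) * s by ring, hr, one_mul]

end SymmetricForm

theorem eigenvalues_ne_zero_of_mul_eq_one {A B : Matrix n n ℂ} (hA : A.IsHermitian)
    (h : A * B = 1) (i : n) : hA.eigenvalues i ≠ 0 := by
  have hdet := (isUnit_det_of_right_inverse h).ne_zero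
  rw [hA.det_eq_prod_eigenvalues] at hdet
  exact Complex.ofReal_ne_zero.1 (Finset.prod_ne_zero_iff.1 hdet i (Finset.mem_univ i))

theorem eq_one_of_prod_X_sub_C_inv_eq {ξ : Fin 4 → ℝ} (hξ : Antitone ξ) (h2 : 0 < ξ 2)
    (h3 : ξ 3 < 0) (h : ∏ i, (Polynomial.X - Polynomial.C ((ξ i)⁻¹ : ℂ)) =
      ∏ i, (Polynomial.X - Polynomial.C (ξ i : ℂ))) :
    ξ 1 = 1 ∧ ξ 3 = -1 ∧ ξ 0 * ξ 2 = 1 := by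
  have h12 : ξ 2 ≤ ξ 1 := hξ (by decide)
  have h01 : ξ 1 ≤ ξ 0 := hξ (by decide)
  have h1 : 0 < ξ 1 := h2.trans_le h12
  have hanti : Antitone ![(ξ 2)⁻¹, (ξ 1)⁻¹, (ξ 0)⁻¹, (ξ 3)⁻¹] := by
    refine Fin.antitone_iff_succ_le.2 fun i => ?_
    fin_cases i
    · exact inv_anti₀ h2 h12
    · exact inv_anti₀ h1 h01
    · exact (inv_lt_zero.2 h3).le.trans (inv_nonneg.2 (h1.trans_le h01).le)
  have heq := eq_of_antitone_of_prod_X_sub_C_eq hanti hξ (by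
    rw [← h]
    simp only [Fin.prod_univ_four, cons_val, Complex.ofReal_inv]
    ring)
  have e0 : (ξ 2)⁻¹ = ξ 0 := congrFun heq 0
  have e1 : (ξ 1)⁻¹ = ξ 1 := congrFun heq 1
  have e3 : (ξ 3)⁻¹ = ξ 3 := congrFun heq 3
  refine ⟨?_, ?_, by rw [← e0, inv_mul_cancel₀ h2.ne']⟩
  · have := mul_inv_cancel₀ h1.ne'
    rw [e1] at this
    nlinarith
  · have := mul_inv_cancel₀ h3.ne
    rw [e3] at this
    nlinarith

theorem sortedEigenvalues_reflectionWitness {J P : Matrix (Fin 2 × Fin 2) (Fin 2 × Fin 2) ℂ}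
    (hJ : J * J = 1) (hJh : Jᴴ = J) (hP : Pᵀ * J * P = 1) (k : Fin 2 × Fin 2)
    {ξ : Fin 4 → ℝ} (hξ : ξ = sortedEigenvalues (isHermitian_reflectionWitness P k)) :
    0 < ξ 2 ∧ ξ 1 = 1 ∧ ξ 3 = -1 ∧ ξ 0 * ξ 2 = 1 := by
  set hX := isHermitian_reflectionWitness P k
  have hXX := reflectionWitness_mul_eq_one hJh hP k
  have hanti : Antitone ξ := hξ ▸ sortedEigenvalues_antitone hX
  obtain ⟨e, he⟩ := exists_equiv_eigenvalues_eq hX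
  have hev : ∀ i, hX.eigenvalues (e.symm i) = ξ i := fun i => by rw [he, hξ]; simp
  have h3 : ξ 3 < 0 := by
    by_contra! h3
    refine not_posSemidef_reflectionWitness hP k
      ((posSemidef_iff_sortedEigenvalues_nonneg hX).2 fun i => ?_)
    exact hξ ▸ h3.trans (hanti (Fin.le_last i))
  have h2 : 0 < ξ 2 := by
    have hne := eigenvalues_ne_zero_of_mul_eq_one hX hXX (e.symm 2)
    have hor := nonneg_or_nonneg_eigenvalues_reflectionWitness P k
      (e.symm.injective.ne (show (2 : Fin 4) ≠ 3 by decide))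
    rw [hev] at hne hor
    rw [hev] at hor
    exact (hor.resolve_right h3.not_ge).lt_of_ne' hne
  refine ⟨h2, eq_one_of_prod_X_sub_C_inv_eq hanti h2 h3 ?_⟩
  have hcfc : cfc (fun x : ℝ => x⁻¹) (reflectionWitness P k) = (reflectionWitness P k)⁻¹ := by
    have := cfc_inv_id (R := ℝ) (Units.mkOfMulEqOne _ _ hXX) hX.isSelfAdjoint
    rw [coe_units_inv] at this
    exact this
  have hinv := charpoly_inv_reflectionWitness hJ hJh hP k
  rw [← hcfc, charpoly_cfc_eq_prod_sortedEigenvalues hX,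
    charpoly_eq_prod_sortedEigenvalues hX, ← hξ] at hinv
  simpa only [Complex.ofReal_inv] using hinv

theorem two_mul_le_sum_of_orthogonal_conj_eq {ρ J P : Matrix (Fin 2 × Fin 2) (Fin 2 × Fin 2) ℂ}
    (hρ : ρ.PosSemidef) {ev : Fin 4 → ℝ} (hev : ev = sortedEigenvalues hρ.isHermitian)
    (hcrit : ev 0 - ev 2 ≤ 2 * √(ev 1 * ev 3)) (hJ : J * J = 1) (hJh : Jᴴ = J)
    (hP : Pᵀ * J * P = 1) {s : Fin 2 × Fin 2 → ℝ} (hs : Pᴴ * ρ * P = realDiagonal s)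
    (k : Fin 2 × Fin 2) : 2 * s k ≤ ∑ i, s i := by
  have hX := isHermitian_reflectionWitness P k
  have htrace := sum_sortedEigenvalues_mul_rev_le_re_trace hρ.isHermitian hX
  obtain ⟨hξ2, hξ1, hξ3, hξ02⟩ := sortedEigenvalues_reflectionWitness hJ hJh hP k rfl
  have hnonneg : ∀ i, 0 ≤ ev i := hev ▸ (posSemidef_iff_sortedEigenvalues_nonneg _).1 hρ
  rw [trace_mul_reflectionWitness hs, Complex.ofReal_re, ← hev, Fin.sum_univ_four] at htrace
  set ξ := sortedEigenvalues hX
  change ev 0 * ξ 3 + ev 1 * ξ 2 + ev 2 * ξ 1 + ev 3 * ξ 0 ≤ _ at htrace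
  have hamgm : 2 * √(ev 1 * ev 3) ≤ ev 1 * ξ 2 + ev 3 * ξ 0 := by
    have hξ0 : 0 < ξ 0 := pos_of_mul_pos_left (hξ02 ▸ one_pos) hξ2.le
    have hsqrt : √(ev 1 * ev 3) = √(ev 1 * ξ 2) * √(ev 3 * ξ 0) := by
      rw [← Real.sqrt_mul (mul_nonneg (hnonneg 1) hξ2.le)]
      congr 1
      linear_combination -(ev 1 * ev 3) * hξ02
    rw [hsqrt, ← mul_assoc]
    refine (two_mul_le_add_sq _ _).trans_eq ?_
    rw [Real.sq_sqrt (mul_nonneg (hnonneg 1) hξ2.le), Real.sq_sqrt (mul_nonneg (hnonneg 3) hξ0.le)]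
  rw [hξ1, hξ3] at htrace
  linarith

/-! ### Decompositions of vanishing concurrence -/

theorem exists_mul_conjTranspose_eq_and_congr_eq_realDiagonal {ρ J : Matrix n n ℂ}
    (hρ : ρ.PosSemidef) (hJt : Jᵀ = J) :
    ∃ (W : Matrix n n ℂ) (s : n → ℝ),
      (∀ i, 0 ≤ s i) ∧ W * Wᴴ = ρ ∧ Wᵀ * J * W = realDiagonal s := by
  obtain ⟨B, rfl⟩ : ∃ B : Matrix n n ℂ, ρ = B * Bᴴ := by
    open scoped MatrixOrder Matrix.Norms.L2Operator in
    exact CStarAlgebra.nonneg_iff_eq_mul_star_self.1 hρ.nonneg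
  obtain ⟨V, hV, s, hs, hVs⟩ := exists_unitary_congr_eq_realDiagonal (M := Bᵀ * J * B) (by
    simp only [transpose_mul, transpose_transpose, hJt, mul_assoc])
  have hVV : V * Vᴴ = 1 := mem_unitaryGroup_iff.1 hV
  refine ⟨B * V, s, hs, ?_, ?_⟩
  · rw [conjTranspose_mul, mul_assoc, ← mul_assoc V, hVV, one_mul]
  · rw [← hVs]
    simp only [transpose_mul, mul_assoc]

theorem ne_zero_of_congr_eq_realDiagonal {W J : Matrix n n ℂ} {s : n → ℝ}
    (hW : (W * Wᴴ).PosDef) (hJ : J * J = 1) (h : Wᵀ * J * W = realDiagonal s) (i : n) :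
    s i ≠ 0 := by
  have hWu : IsUnit W.det :=
    isUnit_of_mul_isUnit_left (det_mul W Wᴴ ▸ (isUnit_iff_isUnit_det _).1 hW.isUnit)
  have hdet : IsUnit (realDiagonal s).det := by
    rw [← h, det_mul, det_mul, det_transpose]
    exact (hWu.mul (isUnit_det_of_right_inverse hJ)).mul hWu
  rw [realDiagonal_eq_diagonal, det_diagonal] at hdet
  exact Complex.ofReal_ne_zero.1 (Finset.prod_ne_zero_iff.1 hdet.ne_zero i (Finset.mem_univ i))

theorem exists_norm_eq_one_mul_add_mul_eq {a b d : ℝ} (h1 : |a - b| ≤ d) (h2 : d ≤ a + b) :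
    ∃ u v : ℂ, ‖u‖ = 1 ∧ ‖v‖ = 1 ∧ a * u + b * v = d := by
  have hcont : ContinuousOn (fun θ : ℝ => ‖(a : ℂ) + b * Complex.exp (θ * Complex.I)‖)
      (Set.Icc 0 Real.pi) := by fun_prop
  obtain ⟨θ, -, hθ : ‖(a : ℂ) + b * Complex.exp (θ * Complex.I)‖ = d⟩ :=
    intermediate_value_Icc' Real.pi_pos.le hcont (show d ∈ Set.Icc _ _ by
      constructor
      · simpa [← sub_eq_add_neg, ← Complex.ofReal_sub] using h1
      · simpa [← Complex.ofReal_add] using h2.trans (le_abs_self _))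
  set z : ℂ := a + b * Complex.exp (θ * Complex.I) with hz
  have hrot : Complex.exp (-z.arg * Complex.I) * z = d := by
    nth_rw 2 [← Complex.norm_mul_exp_arg_mul_I z]
    rw [hθ, mul_left_comm, ← Complex.exp_add, neg_mul, neg_add_cancel, Complex.exp_zero, mul_one]
  have hnorm : ‖Complex.exp (-z.arg * Complex.I)‖ = 1 := by
    rw [← Complex.ofReal_neg, Complex.norm_exp_ofReal_mul_I]
  refine ⟨Complex.exp (-z.arg * Complex.I),
    Complex.exp (-z.arg * Complex.I) * Complex.exp (θ * Complex.I), hnorm, ?_, ?_⟩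
  · rw [norm_mul, hnorm, Complex.norm_exp_ofReal_mul_I, one_mul]
  · rw [← hrot, hz]
    ring

theorem exists_norm_eq_one_sum_mul_eq_zero {s : Fin 2 × Fin 2 → ℝ} (hs : ∀ i, 0 ≤ s i)
    (h : ∀ k, 2 * s k ≤ ∑ i, s i) :
    ∃ u : Fin 2 × Fin 2 → ℂ, (∀ i, ‖u i‖ = 1) ∧ ∑ i, s i * u i = 0 := by
  simp only [Fintype.sum_prod_type, Fin.sum_univ_two, Prod.forall, Fin.forall_fin_two] at hs h ⊢
  set d := max |s (0, 0) - s (0, 1)| |s (1, 0) - s (1, 1)|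
  have hd : d ≤ s (0, 0) + s (0, 1) ∧ d ≤ s (1, 0) + s (1, 1) := by
    simp only [d, max_le_iff, abs_le]
    grind
  obtain ⟨u, v, hu, hv, huv⟩ := exists_norm_eq_one_mul_add_mul_eq (le_max_left _ _) hd.1
  obtain ⟨u', v', hu', hv', huv'⟩ := exists_norm_eq_one_mul_add_mul_eq (le_max_right _ _) hd.2
  refine ⟨fun i => ![![u, v], ![-u', -v']] i.1 i.2, by simp [*], ?_⟩
  simp only [cons_val]
  linear_combination huv - huv'

/-- The real `4 × 4` Hadamard matrix, normalized to be unitary. -/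
def hadamardMatrix : Matrix (Fin 2 × Fin 2) (Fin 2 × Fin 2) ℂ :=
  (1 / 2 : ℂ) • (!![1, 1; 1, -1] ⊗ₖ !![1, 1; 1, -1])

theorem hadamardMatrix_mem_unitaryGroup : hadamardMatrix ∈ unitaryGroup (Fin 2 × Fin 2) ℂ := by
  rw [mem_unitaryGroup_iff]
  ext ⟨i, j⟩ ⟨k, l⟩
  fin_cases i <;> fin_cases j <;> fin_cases k <;> fin_cases l <;>
    simp [hadamardMatrix, mul_apply, Fintype.sum_prod_type] <;> norm_num

theorem hadamardMatrix_apply_mul_self (i j : Fin 2 × Fin 2) :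
    hadamardMatrix i j * hadamardMatrix i j = 1 / 4 := by
  obtain ⟨i, i'⟩ := i
  obtain ⟨j, j'⟩ := j
  fin_cases i <;> fin_cases i' <;> fin_cases j <;> fin_cases j' <;>
    simp [hadamardMatrix] <;> norm_num

theorem diag_hadamardMatrix_congr_diagonal (d : Fin 2 × Fin 2 → ℂ) :
    (hadamardMatrixᵀ * diagonal d * hadamardMatrix).diag = fun _ => 1 / 4 * ∑ i, d i := by
  ext j
  rw [diag_apply, mul_apply, Finset.mul_sum]
  refine Finset.sum_congr rfl fun i _ => ?_
  rw [mul_diagonal, transpose_apply]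
  linear_combination d i * hadamardMatrix_apply_mul_self i j

omit [Fintype n] [DecidableEq n] in
theorem exists_mul_self_eq_of_norm_eq_one {u : n → ℂ} (hu : ∀ i, ‖u i‖ = 1) :
    ∃ z : n → ℂ, (∀ i, ‖z i‖ = 1) ∧ ∀ i, z i * z i = u i := by
  choose z hz using fun i => IsAlgClosed.exists_pow_nat_eq (u i) two_pos
  refine ⟨z, fun i => ?_, fun i => by rw [← sq, hz]⟩
  rw [← pow_eq_one_iff_of_nonneg (norm_nonneg _) two_ne_zero, ← norm_pow, hz, hu]

/-- The pure-state decompositions `∑ⱼ |wⱼ⟩⟨wⱼ|` into columns `wⱼ` isotropic for the symmetric form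
`J`, which for the spin flip means of vanishing concurrence. -/
def isotropicFactors (J : Matrix n n ℂ) : Set (Matrix n n ℂ) :=
  {W | (Wᵀ * J * W).diag = 0}

theorem exists_mem_isotropicFactors_of_two_mul_le_sum
    {J W : Matrix (Fin 2 × Fin 2) (Fin 2 × Fin 2) ℂ} {s : Fin 2 × Fin 2 → ℝ} (hs : ∀ i, 0 ≤ s i)
    (hW : Wᵀ * J * W = realDiagonal s) (h : ∀ k, 2 * s k ≤ ∑ i, s i) :
    ∃ V ∈ isotropicFactors J, V * Vᴴ = W * Wᴴ := by
  obtain ⟨u, hu, hsum⟩ := exists_norm_eq_one_sum_mul_eq_zero hs h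
  obtain ⟨z, hz, hzu⟩ := exists_mul_self_eq_of_norm_eq_one hu
  set H := diagonal z * hadamardMatrix with hH
  have hHH : H * Hᴴ = 1 :=
    mem_unitaryGroup_iff.1 (mul_mem (diagonal_mem_unitaryGroup hz) hadamardMatrix_mem_unitaryGroup)
  refine ⟨W * H, ?_, ?_⟩
  · have hcongr : (W * H)ᵀ * J * (W * H) =
        hadamardMatrixᵀ * diagonal (fun i => s i * u i) * hadamardMatrix := by
      calc (W * H)ᵀ * J * (W * H)
          = hadamardMatrixᵀ * (diagonal z * (Wᵀ * J * W) * diagonal z) * hadamardMatrix := by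
            simp only [hH, transpose_mul, diagonal_transpose, mul_assoc]
        _ = hadamardMatrixᵀ * diagonal (fun i => s i * u i) * hadamardMatrix := by
            rw [hW, realDiagonal_eq_diagonal, diagonal_mul_diagonal, diagonal_mul_diagonal]
            congr 3
            ext i
            rw [← hzu]
            ring
    rw [isotropicFactors, Set.mem_ofPred_eq, hcongr, diag_hadamardMatrix_congr_diagonal, hsum,
      mul_zero]
    rfl
  · rw [conjTranspose_mul, mul_assoc, ← mul_assoc H, hHH, one_mul]

theorem exists_mem_isotropicFactors_of_posDef {ρ J : Matrix (Fin 2 × Fin 2) (Fin 2 × Fin 2) ℂ}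
    (hρ : ρ.PosDef) {ev : Fin 4 → ℝ} (hev : ev = sortedEigenvalues hρ.isHermitian)
    (hcrit : ev 0 - ev 2 ≤ 2 * √(ev 1 * ev 3)) (hJ : J * J = 1) (hJt : Jᵀ = J) (hJh : Jᴴ = J) :
    ∃ W ∈ isotropicFactors J, W * Wᴴ = ρ := by
  obtain ⟨W, s, hs, rfl, hW⟩ :=
    exists_mul_conjTranspose_eq_and_congr_eq_realDiagonal hρ.posSemidef hJt
  have hpos i : 0 < s i := (hs i).lt_of_ne' (ne_zero_of_congr_eq_realDiagonal hρ hJ hW i)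
  obtain ⟨P, hP, hPs⟩ := exists_orthogonal_conj_eq_realDiagonal hJ hJt hJh hpos hW
  exact exists_mem_isotropicFactors_of_two_mul_le_sum hs hW
    (two_mul_le_sum_of_orthogonal_conj_eq hρ.posSemidef hev hcrit hJ hJh hP hPs)

open scoped Matrix.Norms.L2Operator in
omit [DecidableEq n] in
theorem isProperMap_mul_conjTranspose_self :
    IsProperMap fun W : Matrix n n ℂ => W * Wᴴ := by
  classical
  have : ProperSpace (Matrix n n ℂ) := FiniteDimensional.proper ℂ _
  refine isProperMap_iff_tendsto_cocompact.2 ⟨by fun_prop, ?_⟩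
  rw [← Metric.cobounded_eq_cocompact, ← tendsto_norm_atTop_iff_cobounded]
  have hnorm (W : Matrix n n ℂ) : ‖W * Wᴴ‖ = ‖W‖ * ‖W‖ := CStarRing.norm_self_mul_star
  simp only [hnorm]
  exact Filter.tendsto_mul_self_atTop.comp tendsto_norm_cobounded_atTop

omit [DecidableEq n] in
theorem isClosed_image_isotropicFactors (J : Matrix n n ℂ) :
    IsClosed ((fun W => W * Wᴴ) '' isotropicFactors J) :=
  isProperMap_mul_conjTranspose_self.isClosedMap _ (isClosed_eq (by fun_prop) continuous_const)

theorem exists_mem_isotropicFactors {ρ J : Matrix (Fin 2 × Fin 2) (Fin 2 × Fin 2) ℂ}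
    (hρ : ρ.PosSemidef) {ev : Fin 4 → ℝ} (hev : ev = sortedEigenvalues hρ.isHermitian)
    (hcrit : ev 0 - ev 2 ≤ 2 * √(ev 1 * ev 3)) (hJ : J * J = 1) (hJt : Jᵀ = J) (hJh : Jᴴ = J) :
    ∃ W ∈ isotropicFactors J, W * Wᴴ = ρ := by
  have hlim : Filter.Tendsto (fun t : ℝ => ρ + t • 1) (nhdsWithin 0 (Set.Ioi 0)) (nhds ρ) := by
    refine Filter.Tendsto.mono_left ?_ nhdsWithin_le_nhds
    exact Continuous.tendsto' (by fun_prop) _ _ (by simp)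
  refine (isClosed_image_isotropicFactors J).mem_of_tendsto hlim ?_
  filter_upwards [self_mem_nhdsWithin] with t (ht : 0 < t)
  have hpos : (ρ + t • 1).PosDef := PosDef.posSemidef_add hρ (PosDef.one.smul ht)
  refine exists_mem_isotropicFactors_of_posDef hpos rfl ?_ hJ hJt hJh
  have hnonneg := (posSemidef_iff_sortedEigenvalues_nonneg hρ.isHermitian).1 hρ
  rw [← hev] at hnonneg
  rw [sortedEigenvalues_eq_of_eq_smul_add_smul_one hρ.isHermitian hpos.isHermitian zero_le_one
    (by rw [one_smul]), ← hev]
  simp only [one_mul]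
  have hmono : √(ev 1 * ev 3) ≤ √((ev 1 + t) * (ev 3 + t)) := by
    have := hnonneg 1
    have := hnonneg 3
    gcongr <;> linarith
  linarith

/-! ### The spectral criterion -/

theorem exists_isState (m : Type*) [Fintype m] [Nonempty m] : ∃ ρ : Matrix m m ℂ, IsState ρ := by
  classical
  obtain ⟨i⟩ := ‹Nonempty m›
  refine ⟨vecMulVec (Pi.single i 1) (star (Pi.single i 1)), posSemidef_vecMulVec_self_star _, ?_⟩
  simp [trace_vecMulVec]

theorem exists_isState_eq_smul {m : Type*} [Fintype m] [Nonempty m] {A : Matrix m m ℂ}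
    (hA : A.PosSemidef) : ∃ r : ℝ, 0 ≤ r ∧ ∃ ρ, IsState ρ ∧ A = r • ρ := by
  obtain ⟨r, hr, htr⟩ : ∃ r : ℝ, 0 ≤ r ∧ (r : ℂ) = A.trace :=
    RCLike.nonneg_iff_exists_ofReal.1 hA.trace_nonneg
  rcases hr.eq_or_lt with rfl | hpos
  · obtain ⟨ρ, hρ⟩ := exists_isState m
    exact ⟨0, le_rfl, ρ, hρ, by rw [zero_smul, hA.trace_eq_zero_iff.1 (by simpa using htr.symm)]⟩
  · refine ⟨r, hr, r⁻¹ • A, ⟨hA.smul (inv_nonneg.2 hr), ?_⟩, (smul_inv_smul₀ hpos.ne' A).symm⟩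
    rw [trace_smul, ← htr, Complex.real_smul, ← Complex.ofReal_mul, inv_mul_cancel₀ hpos.ne',
      Complex.ofReal_one]

theorem exists_mem_separableStates_kronecker_eq_smul {m k : Type*} [Fintype m] [Fintype k]
    [Nonempty m] [Nonempty k] {A : Matrix m m ℂ} {B : Matrix k k ℂ} (hA : A.PosSemidef)
    (hB : B.PosSemidef) : ∃ r : ℝ, 0 ≤ r ∧ ∃ ρ ∈ separableStates m k, A ⊗ₖ B = r • ρ := by
  obtain ⟨r, hr, ρ, hρ, rfl⟩ := exists_isState_eq_smul hA
  obtain ⟨t, ht, τ, hτ, rfl⟩ := exists_isState_eq_smul hB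
  refine ⟨r * t, mul_nonneg hr ht, ρ ⊗ₖ τ, subset_convexHull ℝ _ ⟨ρ, τ, hρ, hτ, rfl⟩, ?_⟩
  rw [smul_kronecker, kronecker_smul, smul_smul]

theorem trace_eq_one_of_mem_separableStates {m k : Type*} [Fintype m] [Fintype k]
    {ρ : Matrix (m × k) (m × k) ℂ} (h : ρ ∈ separableStates m k) : ρ.trace = 1 := by
  have hconv : Convex ℝ {ρ : Matrix (m × k) (m × k) ℂ | ρ.trace = 1} :=
    convex_singleton (1 : ℂ) |>.linear_preimage (traceLinearMap (m × k) ℝ ℂ)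
  refine convexHull_min ?_ hconv h
  rintro _ ⟨a, b, ha, hb, rfl⟩
  rw [Set.mem_ofPred_eq, trace_kronecker, ha.2, hb.2, one_mul]

theorem exists_eq_mul_of_det_eq_zero {z : Fin 2 × Fin 2 → ℂ}
    (h : z (0, 0) * z (1, 1) = z (0, 1) * z (1, 0)) :
    ∃ a b : Fin 2 → ℂ, ∀ p, z p = a p.1 * b p.2 := by
  by_cases h00 : z (0, 0) = 0
  · rw [h00, zero_mul] at h
    rcases mul_eq_zero.1 h.symm with h01 | h10
    · refine ⟨![0, 1], ![z (1, 0), z (1, 1)], ?_⟩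
      rintro ⟨i, j⟩
      fin_cases i <;> fin_cases j <;> simp [h00, h01]
    · refine ⟨![z (0, 1), z (1, 1)], ![0, 1], ?_⟩
      rintro ⟨i, j⟩
      fin_cases i <;> fin_cases j <;> simp [h00, h10]
  · refine ⟨![z (0, 0), z (1, 0)], ![1, z (0, 1) / z (0, 0)], ?_⟩
    have h11 : z (1, 1) = z (1, 0) * (z (0, 1) / z (0, 0)) := by
      rw [← mul_div_assoc, eq_div_iff h00]
      linear_combination h
    rintro ⟨i, j⟩
    fin_cases i <;> fin_cases j <;> simp [h00, h11, mul_div_cancel₀]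

theorem exists_mem_separableStates_vecMulVec_eq_smul {z : Fin 2 × Fin 2 → ℂ}
    (h : z (0, 0) * z (1, 1) = z (0, 1) * z (1, 0)) :
    ∃ r : ℝ, 0 ≤ r ∧ ∃ ρ ∈ separableStates (Fin 2) (Fin 2), vecMulVec z (star z) = r • ρ := by
  obtain ⟨a, b, hab⟩ := exists_eq_mul_of_det_eq_zero h
  have hz : vecMulVec z (star z) = vecMulVec a (star a) ⊗ₖ vecMulVec b (star b) := by
    ext p q
    simp only [vecMulVec_apply, kroneckerMap_apply, Pi.star_apply, hab, star_mul']
    ring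
  rw [hz]
  exact exists_mem_separableStates_kronecker_eq_smul (posSemidef_vecMulVec_self_star a)
    (posSemidef_vecMulVec_self_star b)

/-- The spin flip `σ_y ⊗ σ_y` up to a sign; the symmetric form it defines vanishes exactly on the
product vectors. -/
def spinFlip : Matrix (Fin 2 × Fin 2) (Fin 2 × Fin 2) ℂ :=
  !![0, 1; -1, 0] ⊗ₖ !![0, 1; -1, 0]

theorem transpose_spinFlip : spinFlipᵀ = spinFlip := by
  ext ⟨i, j⟩ ⟨k, l⟩
  fin_cases i <;> fin_cases j <;> fin_cases k <;> fin_cases l <;> simp [spinFlip]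

theorem conjTranspose_spinFlip : spinFlipᴴ = spinFlip := by
  ext ⟨i, j⟩ ⟨k, l⟩
  fin_cases i <;> fin_cases j <;> fin_cases k <;> fin_cases l <;> simp [spinFlip]

theorem spinFlip_mul_self : spinFlip * spinFlip = 1 := by
  ext ⟨i, j⟩ ⟨k, l⟩
  fin_cases i <;> fin_cases j <;> fin_cases k <;> fin_cases l <;>
    simp [spinFlip, mul_apply, Fintype.sum_prod_type]

theorem diag_transpose_mul_spinFlip_mul {k : Type*} (W : Matrix (Fin 2 × Fin 2) k ℂ) (j : k) :
    (Wᵀ * spinFlip * W).diag j =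
      2 * (W (0, 0) j * W (1, 1) j - W (0, 1) j * W (1, 0) j) := by
  simp only [diag_apply, mul_apply, Fintype.sum_prod_type, spinFlip, transpose_apply,
    kroneckerMap_apply, of_apply, cons_val', cons_val_zero, cons_val_one, cons_val_fin_one,
    Fin.sum_univ_two]
  ring

theorem mul_conjTranspose_mem_separableStates {W : Matrix (Fin 2 × Fin 2) (Fin 2 × Fin 2) ℂ}
    (htr : (W * Wᴴ).trace = 1) (hW : W ∈ isotropicFactors spinFlip) :
    W * Wᴴ ∈ separableStates (Fin 2) (Fin 2) := by
  have hdet j : W (0, 0) j * W (1, 1) j = W (0, 1) j * W (1, 0) j := by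
    have hdiag := diag_transpose_mul_spinFlip_mul W j
    rw [isotropicFactors, Set.mem_ofPred_eq] at hW
    rw [hW, Pi.zero_apply] at hdiag
    linear_combination -(1 / 2) * hdiag
  choose r hr ρ hρ hz using fun j =>
    exists_mem_separableStates_vecMulVec_eq_smul (z := fun p => W p j) (hdet j)
  have hsum : W * Wᴴ = ∑ j, r j • ρ j := by
    simp_rw [← hz]
    ext p q
    simp [mul_apply, Matrix.sum_apply, vecMulVec_apply]
  have hr1 : ∑ j, r j = 1 := by
    rw [hsum, trace_sum] at htr
    simp_rw [trace_smul, trace_eq_one_of_mem_separableStates (hρ _), Complex.real_smul,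
      mul_one] at htr
    exact_mod_cast htr
  rw [hsum]
  exact (convex_convexHull ℝ _).sum_mem (fun j _ => hr j) hr1 fun j _ => hρ j

theorem mem_separableStates_of_le {ρ : Matrix (Fin 2 × Fin 2) (Fin 2 × Fin 2) ℂ}
    (hρ : IsState ρ) {ev : Fin 4 → ℝ} (hev : ev = sortedEigenvalues hρ.isHermitian)
    (hcrit : ev 0 - ev 2 ≤ 2 * √(ev 1 * ev 3)) : ρ ∈ separableStates (Fin 2) (Fin 2) := by
  obtain ⟨W, hW, rfl⟩ := exists_mem_isotropicFactors hρ.1 hev hcrit spinFlip_mul_self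
    transpose_spinFlip conjTranspose_spinFlip
  exact mul_conjTranspose_mem_separableStates hρ.2 hW

theorem IsState.conj {ρ U : Matrix n n ℂ} (hρ : IsState ρ)
    (hU : U ∈ unitaryGroup n ℂ) : IsState (U * ρ * star U) := by
  refine ⟨hρ.1.mul_mul_conjTranspose_same U, ?_⟩
  rw [trace_mul_comm, ← mul_assoc, mem_unitaryGroup_iff'.1 hU, one_mul, hρ.2]

theorem mem_absSepStates_of_le {ρ : Matrix (Fin 2 × Fin 2) (Fin 2 × Fin 2) ℂ} (hρ : IsState ρ)
    {ev : Fin 4 → ℝ} (hev : ev = sortedEigenvalues hρ.isHermitian)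
    (hcrit : ev 0 - ev 2 ≤ 2 * √(ev 1 * ev 3)) : ρ ∈ absSepStates (Fin 2) (Fin 2) := by
  refine ⟨hρ, fun U hU => mem_separableStates_of_le (hρ.conj hU) ?_ hcrit⟩
  rw [hev]
  refine (sortedEigenvalues_eq _ (sortedEigenvalues_antitone _) ?_).symm
  rw [charpoly_unitary_conj hU, charpoly_eq_prod_sortedEigenvalues hρ.isHermitian]

/-- The partial transpose of a matrix on a bipartite system, taken on the second factor. -/
def partialTranspose {m k : Type*} (A : Matrix (m × k) (m × k) ℂ) : Matrix (m × k) (m × k) ℂ :=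
  of fun p q => A (p.1, q.2) (q.1, p.2)

theorem posSemidef_partialTranspose_of_mem_separableStates {m k : Type*} [Fintype m] [Fintype k]
    {ρ : Matrix (m × k) (m × k) ℂ} (h : ρ ∈ separableStates m k) :
    (partialTranspose ρ).PosSemidef := by
  have hconv : Convex ℝ {ρ : Matrix (m × k) (m × k) ℂ | (partialTranspose ρ).PosSemidef} :=
    fun _ hρ _ hτ _ _ ha hb _ => (hρ.smul ha).add (hτ.smul hb)
  refine convexHull_min ?_ hconv h
  rintro _ ⟨a, b, ha, hb, rfl⟩
  exact ha.1.kronecker hb.1.transpose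

omit [Fintype n] [DecidableEq n] in
theorem norm_sq_le_of_posSemidef {A : Matrix n n ℂ} (hA : A.PosSemidef) (i j : n) :
    ‖A i j‖ ^ 2 ≤ (A i i).re * (A j j).re := by
  have hdet := (hA.submatrix ![i, j]).det_nonneg
  have hi : A i i = (A i i).re := (hA.isHermitian.coe_re_apply_self i).symm
  have hj : A j j = (A j j).re := (hA.isHermitian.coe_re_apply_self j).symm
  simp only [det_fin_two, submatrix_apply, cons_val_zero, cons_val_one] at hdet
  rw [hi, hj, ← hA.isHermitian.apply j i, RCLike.star_def, Complex.mul_conj'] at hdet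
  exact sub_nonneg.1 (by exact_mod_cast hdet)

/-- The unitary matrix with the maximally entangled vectors `(|00⟩ ± |11⟩) / √2` in the columns
`(0, 0)`, `(1, 0)` and with `|01⟩`, `|10⟩` in the columns `(0, 1)`, `(1, 1)`; it conjugates the
diagonal matrices to the states for which the partial transpose test is the spectral criterion. -/
def bellBasis : Matrix (Fin 2 × Fin 2) (Fin 2 × Fin 2) ℂ :=
  of fun p q =>
    ![![!![((√2 : ℝ) : ℂ)⁻¹, 0; ((√2 : ℝ) : ℂ)⁻¹, 0], !![0, 1; 0, 0]],
      ![!![0, 0; 0, 1], !![((√2 : ℝ) : ℂ)⁻¹, 0; -((√2 : ℝ) : ℂ)⁻¹, 0]]] p.1 p.2 q.1 q.2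

theorem inv_sqrt_two_mul_self : ((√2 : ℝ) : ℂ)⁻¹ * ((√2 : ℝ) : ℂ)⁻¹ = 1 / 2 := by
  rw [← mul_inv, ← Complex.ofReal_mul, Real.mul_self_sqrt two_pos.le, Complex.ofReal_ofNat, one_div]

theorem bellBasis_mem_unitaryGroup : bellBasis ∈ unitaryGroup (Fin 2 × Fin 2) ℂ := by
  have h := inv_sqrt_two_mul_self
  rw [mem_unitaryGroup_iff]
  ext ⟨i, j⟩ ⟨k, l⟩
  fin_cases i <;> fin_cases j <;> fin_cases k <;> fin_cases l <;>
    simp [bellBasis, mul_apply, Fintype.sum_prod_type, h] <;> norm_num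

theorem conj_realDiagonal_apply (U : Matrix n n ℂ) (s : n → ℝ) (i j : n) :
    (U * realDiagonal s * star U) i j = ∑ k, U i k * s k * star (U j k) := by
  rw [mul_apply]
  simp only [realDiagonal_eq_diagonal, mul_diagonal, star_apply]

theorem bellBasis_conj_realDiagonal_apply (s : Fin 2 × Fin 2 → ℝ) :
    (bellBasis * realDiagonal s * star bellBasis) (0, 1) (0, 1) = s (0, 1) ∧
      (bellBasis * realDiagonal s * star bellBasis) (1, 0) (1, 0) = s (1, 1) ∧
      (bellBasis * realDiagonal s * star bellBasis) (0, 0) (1, 1) =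
        ((s (0, 0) - s (1, 0)) / 2 : ℝ) := by
  simp only [conj_realDiagonal_apply, Fintype.sum_prod_type, Fin.sum_univ_two, bellBasis, of_apply,
    cons_val', cons_val_zero, cons_val_one, cons_val_fin_one, RCLike.star_def, map_one, map_neg,
    map_inv₀, Complex.conj_ofReal, Complex.ofReal_div, Complex.ofReal_sub, Complex.ofReal_ofNat]
  refine ⟨by ring, by ring, ?_⟩
  linear_combination (s (0, 0) - s (1, 0) : ℂ) * inv_sqrt_two_mul_self

theorem sq_sub_le_of_bellBasis_conj_mem_separableStates {s : Fin 2 × Fin 2 → ℝ}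
    (h : bellBasis * realDiagonal s * star bellBasis ∈ separableStates (Fin 2) (Fin 2)) :
    (s (0, 0) - s (1, 0)) ^ 2 ≤ 4 * (s (0, 1) * s (1, 1)) := by
  obtain ⟨h01, h10, h00⟩ := bellBasis_conj_realDiagonal_apply s
  have hminor := norm_sq_le_of_posSemidef (posSemidef_partialTranspose_of_mem_separableStates h)
    (0, 1) (1, 0)
  simp only [partialTranspose, of_apply, h01, h10, h00, Complex.norm_real, Complex.ofReal_re,
    Real.norm_eq_abs, sq_abs] at hminor
  linarith

theorem sq_sub_le_of_mem_absSepStates {ρ : Matrix (Fin 2 × Fin 2) (Fin 2 × Fin 2) ℂ}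
    (h : ρ ∈ absSepStates (Fin 2) (Fin 2)) {ev : Fin 4 → ℝ}
    (hev : ev = sortedEigenvalues h.1.isHermitian) :
    (ev 0 - ev 2) ^ 2 ≤ 4 * (ev 1 * ev 3) := by
  set s : Fin 2 × Fin 2 → ℝ := ev ∘ finProdFinEquiv with hs
  have hherm : (bellBasis * realDiagonal s * star bellBasis).IsHermitian :=
    isHermitian_mul_mul_conjTranspose bellBasis (conjTranspose_realDiagonal s)
  have hcharpoly : ρ.charpoly = (bellBasis * realDiagonal s * star bellBasis).charpoly := by
    rw [charpoly_unitary_conj bellBasis_mem_unitaryGroup, charpoly_realDiagonal,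
      charpoly_eq_prod_sortedEigenvalues h.1.isHermitian, ← hev, hs]
    exact (Equiv.prod_comp (finProdFinEquiv : Fin 2 × Fin 2 ≃ Fin 4)
      fun i => Polynomial.X - Polynomial.C (ev i : ℂ)).symm
  obtain ⟨U, hU, hconj⟩ := exists_unitary_conj_eq_of_charpoly_eq h.1.isHermitian hherm hcharpoly
  exact sq_sub_le_of_bellBasis_conj_mem_separableStates (hconj ▸ h.2 U hU)

theorem mem_absSepStates_iff {ρ : Matrix (Fin 2 × Fin 2) (Fin 2 × Fin 2) ℂ} (hρ : IsState ρ)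
    {ev : Fin 4 → ℝ} (hev : ev = sortedEigenvalues hρ.isHermitian) :
    ρ ∈ absSepStates (Fin 2) (Fin 2) ↔ ev 0 - ev 2 ≤ 2 * √(ev 1 * ev 3) := by
  refine ⟨fun h => ?_, mem_absSepStates_of_le hρ hev⟩
  refine (Real.le_sqrt_of_sq_le (sq_sub_le_of_mem_absSepStates h hev)).trans_eq ?_
  rw [Real.sqrt_mul (by norm_num), show (4 : ℝ) = 2 ^ 2 by norm_num, Real.sqrt_sq two_pos.le]

/-! ### The boundary of the absolutely separable states -/

theorem mem_intrinsicFrontier_of_lineMap_neg_notMem {V : Type*} [AddCommGroup V] [Module ℝ V]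
    [TopologicalSpace V] [IsTopologicalAddGroup V] [ContinuousSMul ℝ V] {s : Set V} {x y : V}
    (hx : x ∈ s) (hy : y ∈ s) (h : ∀ t : ℝ, t < 0 → AffineMap.lineMap x y t ∉ s) :
    x ∈ intrinsicFrontier ℝ s := by
  have hxA := subset_affineSpan ℝ s hx
  have hyA := subset_affineSpan ℝ s hy
  set γ : ℝ → affineSpan ℝ s := fun t =>
    ⟨AffineMap.lineMap x y t, AffineMap.lineMap_mem t hxA hyA⟩
  have hγ_cont : Continuous γ := AffineMap.lineMap_continuous.subtype_mk _
  have hγ_zero : γ 0 = ⟨x, hxA⟩ := Subtype.ext (AffineMap.lineMap_apply_zero x y)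
  refine mem_intrinsicFrontier.2 ⟨⟨x, hxA⟩, ⟨subset_closure hx, fun hint => ?_⟩, rfl⟩
  rw [mem_interior_iff_mem_nhds, ← hγ_zero] at hint
  obtain ⟨t, hts, ht⟩ := ((hγ_cont.continuousAt.eventually hint).filter_mono
    nhdsWithin_le_nhds |>.and (self_mem_nhdsWithin (s := Set.Iio (0 : ℝ)))).exists
  exact h t ht hts

theorem isState_maxMixed : IsState maxMixed := by
  refine ⟨PosSemidef.one.smul (by norm_num), ?_⟩
  simp [maxMixed, trace_smul]

theorem sortedEigenvalues_maxMixed :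
    sortedEigenvalues isState_maxMixed.isHermitian = fun _ => 1 / 4 := by
  rw [sortedEigenvalues_eq_of_eq_smul_add_smul_one isState_maxMixed.isHermitian
    isState_maxMixed.isHermitian le_rfl (b := 1 / 4) (by rw [zero_smul, zero_add, maxMixed])]
  simp

theorem maxMixed_mem_absSepStates : maxMixed ∈ absSepStates (Fin 2) (Fin 2) :=
  (mem_absSepStates_iff isState_maxMixed sortedEigenvalues_maxMixed.symm).2 (by simp)

theorem lineMap_maxMixed (σ : Matrix (Fin 2 × Fin 2) (Fin 2 × Fin 2) ℂ) (t : ℝ) :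
    AffineMap.lineMap σ maxMixed t = (1 - t) • σ + (t / 4) • 1 := by
  rw [AffineMap.lineMap_apply_module, maxMixed, smul_smul, mul_one_div]

theorem sqrt_mul_mul_mul {c : ℝ} (hc : 0 ≤ c) (a b : ℝ) : √(c * a * (c * b)) = c * √(a * b) := by
  rw [mul_mul_mul_comm, Real.sqrt_mul (mul_self_nonneg c), Real.sqrt_mul_self hc]

theorem mem_absSepBoundary_of_eq {σ : Matrix (Fin 2 × Fin 2) (Fin 2 × Fin 2) ℂ} (hσ : IsState σ)
    {μ : Fin 4 → ℝ} (hμ : μ = sortedEigenvalues hσ.isHermitian)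
    (hcrit : μ 0 - μ 2 = 2 * √(μ 1 * μ 3)) : σ ∈ absSepBoundary (Fin 2) (Fin 2) := by
  refine mem_intrinsicFrontier_of_lineMap_neg_notMem ((mem_absSepStates_iff hσ hμ).2 hcrit.le)
    maxMixed_mem_absSepStates fun t ht hmem => ?_
  have hspec := sortedEigenvalues_eq_of_eq_smul_add_smul_one hσ.isHermitian hmem.1.isHermitian
    (by linarith : 0 ≤ 1 - t) (lineMap_maxMixed σ t)
  rw [← hμ] at hspec
  have hnonneg := (posSemidef_iff_sortedEigenvalues_nonneg hmem.1.isHermitian).1 hmem.1.1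
  rw [hspec] at hnonneg
  have hle := (mem_absSepStates_iff hmem.1 hspec.symm).1 hmem
  have hlt : √(((1 - t) * μ 1 + t / 4) * ((1 - t) * μ 3 + t / 4)) < (1 - t) * √(μ 1 * μ 3) := by
    rw [← sqrt_mul_mul_mul (by linarith : 0 ≤ 1 - t)]
    exact Real.sqrt_lt_sqrt (mul_nonneg (hnonneg 1) (hnonneg 3))
      (mul_lt_mul'' (by linarith) (by linarith) (hnonneg 1) (hnonneg 3))
  have hscale : (1 - t) * μ 0 - (1 - t) * μ 2 = 2 * ((1 - t) * √(μ 1 * μ 3)) := by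
    linear_combination (1 - t) * hcrit
  linarith

/-! ### The decomposition of a state in the interior -/

theorem eq_smul_one_of_sortedEigenvalues_eq {A : Matrix (Fin 2 × Fin 2) (Fin 2 × Fin 2) ℂ}
    (hA : A.IsHermitian) {c : ℝ} (h : ∀ i, sortedEigenvalues hA i = c) : A = c • 1 := by
  obtain ⟨U, hU, hAU⟩ := exists_unitary_conj_realDiagonal hA
  obtain ⟨e, he⟩ := exists_equiv_eigenvalues_eq hA
  have hconst : hA.eigenvalues = algebraMap ℝ (Fin 2 × Fin 2 → ℝ) c := by
    rw [he]
    exact funext fun i => h (e i)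
  rw [hAU, hconst, AlgHom.commutes, Algebra.algebraMap_eq_smul_one, mul_smul_comm, mul_one,
    smul_mul_assoc, mem_unitaryGroup_iff.1 hU]

theorem four_mul_sortedEigenvalues_lt_one {ρ : Matrix (Fin 2 × Fin 2) (Fin 2 × Fin 2) ℂ}
    (hρ : IsState ρ) (hne : ρ ≠ maxMixed) : 4 * sortedEigenvalues hρ.isHermitian 3 < 1 := by
  by_contra! hge
  have hsum : ∑ i, sortedEigenvalues hρ.isHermitian i = 1 := by
    rw [sum_sortedEigenvalues, hρ.2, Complex.one_re]
  rw [Fin.sum_univ_four] at hsum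
  have hle (i : Fin 4) := sortedEigenvalues_antitone hρ.isHermitian (Fin.le_last i)
  refine hne (eq_smul_one_of_sortedEigenvalues_eq hρ.isHermitian fun i => ?_)
  have h0 := hle 0
  have h1 := hle 1
  have h2 := hle 2
  simp only [Fin.reduceLast] at h0 h1 h2
  fin_cases i <;> simp only [Fin.zero_eta, Fin.mk_one, Fin.reduceFinMk] <;> linarith

theorem exists_pos_eq_two_mul_sqrt {a b d : ℝ} (hb : 0 ≤ b) (hd : 0 ≤ d) (h : d < 2 * √(a * b)) :
    ∃ ε, 0 < ε ∧ ε ≤ b ∧ d = 2 * √((a - ε) * (b - ε)) := by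
  have hcont : ContinuousOn (fun ε => 2 * √((a - ε) * (b - ε))) (Set.Icc 0 b) := by fun_prop
  obtain ⟨ε, ⟨hε, hεb⟩, hεd⟩ :=
    intermediate_value_Icc' hb hcont (⟨by simpa using hd, by simpa using h.le⟩ : d ∈ Set.Icc _ _)
  refine ⟨ε, hε.lt_of_ne ?_, hεb, hεd.symm⟩
  rintro rfl
  simp only [sub_zero] at hεd
  exact h.ne' hεd

theorem sortedEigenvalues_smul_sub_smul_one {ρ : Matrix (Fin 2 × Fin 2) (Fin 2 × Fin 2) ℂ}
    (hρ : ρ.IsHermitian) {c ε : ℝ} (hc : 0 ≤ c)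
    (h : (c • (ρ - ε • (1 : Matrix (Fin 2 × Fin 2) (Fin 2 × Fin 2) ℂ))).IsHermitian) :
    sortedEigenvalues h = fun i => c * (sortedEigenvalues hρ i - ε) := by
  rw [sortedEigenvalues_eq_of_eq_smul_add_smul_one hρ h hc (b := -(c * ε))]
  · exact funext fun i => by ring
  · rw [smul_sub, smul_smul, neg_smul, sub_eq_add_neg]

theorem isState_smul_sub_smul_one {ρ : Matrix (Fin 2 × Fin 2) (Fin 2 × Fin 2) ℂ}
    (hρ : IsState ρ) {ε : ℝ} (hε : ε ≤ sortedEigenvalues hρ.isHermitian 3) (h4 : 4 * ε < 1) :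
    IsState ((1 - 4 * ε)⁻¹ • (ρ - ε • (1 : Matrix (Fin 2 × Fin 2) (Fin 2 × Fin 2) ℂ))) := by
  have hc : 0 < 1 - 4 * ε := sub_pos.2 h4
  have hherm :
      ((1 - 4 * ε)⁻¹ • (ρ - ε • (1 : Matrix (Fin 2 × Fin 2) (Fin 2 × Fin 2) ℂ))).IsHermitian :=
    (hρ.isHermitian.sub (isHermitian_one.smul (.all ε))).smul (.all _)
  refine ⟨(posSemidef_iff_sortedEigenvalues_nonneg hherm).2 fun i => ?_, ?_⟩
  · rw [sortedEigenvalues_smul_sub_smul_one hρ.isHermitian (inv_nonneg.2 hc.le)]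
    have := sortedEigenvalues_antitone hρ.isHermitian (Fin.le_last i)
    exact mul_nonneg (inv_nonneg.2 hc.le) (sub_nonneg.2 (hε.trans this))
  · have htrace : (ρ - ε • (1 : Matrix (Fin 2 × Fin 2) (Fin 2 × Fin 2) ℂ)).trace =
        ((1 - 4 * ε : ℝ) : ℂ) := by
      rw [trace_sub, trace_smul, hρ.2, trace_one, Complex.real_smul]
      simp [mul_comm]
    rw [trace_smul, htrace, Complex.real_smul, ← Complex.ofReal_mul, inv_mul_cancel₀ hc.ne',
      Complex.ofReal_one]

end

theorem proposition3
    (ρ : Matrix (Fin 2 × Fin 2) (Fin 2 × Fin 2) ℂ)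
    (hstate : IsState ρ)
    (habs : ρ ∈ absSepStates (Fin 2) (Fin 2))
    (hrank : ρ.rank = 4)
    (hne : ρ ≠ maxMixed)
    (ev : Fin 4 → ℝ)
    (hev : ev = sortedEigenvalues hstate.isHermitian)
    (hlt : ev 0 - ev 2 < 2 * Real.sqrt (ev 1 * ev 3)) :
    ∃ (ε : ℝ) (σ : Matrix (Fin 2 × Fin 2) (Fin 2 × Fin 2) ℂ),
      0 < ε ∧ ε ≤ ev 3 ∧ 4 * ε < 1 ∧
      ev 0 - ev 2 = 2 * Real.sqrt ((ev 1 - ε) * (ev 3 - ε)) ∧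
      σ = (1 - 4 * ε)⁻¹ •
        (ρ - ε • (1 : Matrix (Fin 2 × Fin 2) (Fin 2 × Fin 2) ℂ)) ∧
      σ ∈ absSepStates (Fin 2) (Fin 2) ∧
      σ ∈ absSepBoundary (Fin 2) (Fin 2) ∧
      ρ = (1 - 4 * ε) • σ + (4 * ε) • maxMixed := by
  subst hev
  have hnonneg := (posSemidef_iff_sortedEigenvalues_nonneg hstate.isHermitian).1 hstate.1
  have hanti := sortedEigenvalues_antitone hstate.isHermitian
  obtain ⟨ε, hε, hε3, hcrit⟩ :=
    exists_pos_eq_two_mul_sqrt (hnonneg 3) (sub_nonneg.2 (hanti (by decide))) hlt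
  have h4 : 4 * ε < 1 := by linarith [four_mul_sortedEigenvalues_lt_one hstate hne]
  have hc : 0 < 1 - 4 * ε := sub_pos.2 h4
  have hσ := isState_smul_sub_smul_one hstate hε3 h4
  set μ := sortedEigenvalues hσ.isHermitian with hμ
  have hcritσ : μ 0 - μ 2 = 2 * √(μ 1 * μ 3) := by
    rw [hμ, sortedEigenvalues_smul_sub_smul_one hstate.isHermitian (inv_nonneg.2 hc.le),
      sqrt_mul_mul_mul (inv_nonneg.2 hc.le)]
    linear_combination (1 - 4 * ε)⁻¹ * hcrit
  refine ⟨ε, _, hε, hε3, h4, hcrit, rfl, (mem_absSepStates_iff hσ hμ).2 hcritσ.le,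
    mem_absSepBoundary_of_eq hσ hμ hcritσ, ?_⟩
  rw [smul_inv_smul₀ hc.ne', maxMixed, smul_smul, mul_one_div, mul_div_cancel_left₀ _ four_ne_zero,
    sub_add_cancel]
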